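/- All partial functions are partial boolean functions $f\colon\{0,1\}^n\to\{0,1,*\}$, $n\in\mathbb N$, with domain $\mathrm{Dom}(f)=f^{-1}(\{0,1\})$. For $f$ on $n$ bits and $g$ on $m$ bits, the composition $f\circ g$ is the partial function on $nm$ bits with $(f\circ g)(x^1,\dots,x^n)=f(g(x^1),\dots,g(x^n))$, where $f\circ g$ is undefined (equal to $*$) if some $g(x^i)$ is undefined or $(g(x^1),\dots,g(x^n))\notin\mathrm{Dom}(f)$. A randomised decision tree $R$ is a probability distribution over deterministic decision trees that never query the same bit twice along a path. Let $\mathrm{cost}(R,x)$ be the expected number of queries that $R$ makes on input $x$, let $\mathrm{err}_f(R,x)=\Pr_R[R(x)\ne f(x)]$ and $\mathrm{bias}_f(R,x)=\max\{1-2\,\mathrm{err}_f(R,x),0\}$. Let $\mathrm R(f)$ be the least $T$ such that some randomised decision tree, supported on trees of height at most $T$, satisfies $\mathrm{err}_f(R,x)\le\frac13$ for all $x\in\mathrm{Dom}(f)$. Let $$\mathrm{LR}(f)=\min_R\ \max_{x\in\mathrm{Dom}(f)}\ \frac{\mathrm{cost}(R,x)}{\mathrm{bias}_f(R,x)},$$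 where a ratio with $\mathrm{bias}_f(R,x)=0$, in particular $0/0$, is read as $\infty$, and the maximum over an empty domain is $0$. **Theorem 1.3.** Let $\mathrm M$ be any complexity measure, that is, any assignment of a value $\mathrm M(g)\in[0,\infty]$ to every partial function $g$. Suppose that there is a constant $c>0$ such that $$\mathrm R(f\circ g)\ \ge\ c\cdot\mathrm R(f)\cdot\mathrm M(g)\qquad\text{for all partial functions } f \text{ and } g,$$ with the convention $0\cdot\infty=0$. Then there is a constant $c'>0$ such that $$\mathrm{LR}(g)\ \ge\ c'\cdot\mathrm M(g)\qquad\text{for all partial functions } g.$$ -/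

import Mathlib

open scoped ENNReal

namespace QueryComplexity

/-- A partial boolean function on input bits indexed by `ι`: `f x = some b` means `f(x) = b`,
and `f x = none` means that `f` is undefined on `x` (written `f(x) = *`).
A partial function on `n` bits is a `PartialFun (Fin n)`. -/
abbrev PartialFun (ι : Type) : Type := (ι → Bool) → Option Bool

/-- The domain `f⁻¹({0,1})`. -/
def PartialFun.dom {ι : Type} (f : PartialFun ι) : Set (ι → Bool) := {x | (f x).isSome}

/-- The composition `(f ∘ g)(x) = f(g(x¹), …, g(xⁿ))`, on inputs `x = (x¹, …, xⁿ)` whose bit `j`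
of block `i` is `x (i, j)`. It is defined exactly where every `g(xⁱ)` is defined and
`(g(x¹), …, g(xⁿ))` is in the domain of `f`. -/
noncomputable def PartialFun.comp {ι κ : Type} (f : PartialFun ι) (g : PartialFun κ) : PartialFun (ι × κ) :=
  fun x =>
    open Classical in
    if h : ∀ i, (g fun j => x (i, j)).isSome then
      f fun i => (g fun j => x (i, j)).get (h i)
    else none

/-- Deterministic decision trees with leaves labelled by output bits. `query i t₀ t₁` queries
bit `i` and continues with `t₀` on answer `0` and with `t₁` on answer `1`. -/
inductive DecisionTree (ι : Type) : Type
  | leaf (b : Bool) : DecisionTree ι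
  | query (i : ι) (t₀ t₁ : DecisionTree ι) : DecisionTree ι

namespace DecisionTree

variable {ι : Type}

/-- The output `D(x)`. -/
def eval : DecisionTree ι → (ι → Bool) → Bool
  | leaf b, _ => b
  | query i t₀ t₁, x => if x i then t₁.eval x else t₀.eval x

/-- The number `cost(D, x)` of queries made on input `x`. -/
def cost : DecisionTree ι → (ι → Bool) → ℕ
  | leaf _, _ => 0
  | query i t₀ t₁, x => 1 + if x i then t₁.cost x else t₀.cost x

/-- The height, i.e. the largest number of queries on a root-to-leaf path. -/
def height : DecisionTree ι → ℕ
  | leaf _ => 0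
  | query _ t₀ t₁ => 1 + max t₀.height t₁.height

/-- The indices that label internal nodes. -/
def labels : DecisionTree ι → Set ι
  | leaf _ => ∅
  | query i t₀ t₁ => insert i (t₀.labels ∪ t₁.labels)

/-- No internal node shares its label with an ancestor. -/
def NoRepeat : DecisionTree ι → Prop
  | leaf _ => True
  | query i t₀ t₁ => i ∉ t₀.labels ∧ i ∉ t₁.labels ∧ t₀.NoRepeat ∧ t₁.NoRepeat

end DecisionTree

/-- A randomised decision tree: a probability distribution over deterministic decision trees
that query no index twice along a path. -/
abbrev RandTree (ι : Type) : Type := PMF {D : DecisionTree ι // D.NoRepeat}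

namespace RandTree

variable {ι : Type}

/-- `cost(R, x)`, the expected number of queries that `R` makes on `x`. -/
noncomputable def cost (R : RandTree ι) (x : ι → Bool) : ℝ≥0∞ :=
  ∑' D, R D * (D.1.cost x : ℝ≥0∞)

/-- `err_f(R, x) = Pr[R(x) ≠ f(x)]`. -/
noncomputable def err (f : PartialFun ι) (R : RandTree ι) (x : ι → Bool) : ℝ≥0∞ :=
  ∑' D, R D * (if f x = some (D.1.eval x) then 0 else 1)

/-- `bias_f(R, x) = max {1 - 2 err_f(R, x), 0}`; the maximum with `0` is taken by the truncated
subtraction of `ℝ≥0∞`. -/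
noncomputable def bias (f : PartialFun ι) (R : RandTree ι) (x : ι → Bool) : ℝ≥0∞ :=
  1 - 2 * err f R x

/-- The ratio `cost(R, x) / bias_f(R, x)`, which is `∞` whenever the bias is `0`; in particular
`0 / 0` is read as `∞`. -/
noncomputable def ratio (f : PartialFun ι) (R : RandTree ι) (x : ι → Bool) : ℝ≥0∞ :=
  open Classical in if bias f R x = 0 then ∞ else cost R x / bias f R x

/-- `R` computes `f` with error at most `1/3` and every tree in its support has height at
most `T`. -/
def ComputesWithin (f : PartialFun ι) (R : RandTree ι) (T : ℕ) : Prop :=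
  (∀ x ∈ f.dom, err f R x ≤ 1 / 3) ∧ ∀ D ∈ R.support, D.1.height ≤ T

end RandTree

/-- Randomised (bounded-error, worst-case) query complexity `R(f) = R_{1/3}(f)`. On finitely many
input bits the minimum is over a nonempty set, see `exists_computesWithin`. -/
noncomputable def randQuery {ι : Type} (f : PartialFun ι) : ℕ :=
  sInf {T : ℕ | ∃ R : RandTree ι, R.ComputesWithin f T}

/-- Linearised randomised query complexity
`LR(f) = min_R max_{x ∈ Dom(f)} cost(R, x) / bias_f(R, x)`. -/
noncomputable def linRandQuery {ι : Type} (f : PartialFun ι) : ℝ≥0∞ :=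
  ⨅ R : RandTree ι, ⨆ x ∈ f.dom, R.ratio f x

/-- Every function of the bits in a duplicate-free list is computed by a tree that queries
these bits only. -/
theorem exists_tree_of_list {ι : Type} (l : List ι) (hl : l.Nodup)
    (F : (ι → Bool) → Bool) (hF : ∀ x y, (∀ i ∈ l, x i = y i) → F x = F y) :
    ∃ D : DecisionTree ι, D.NoRepeat ∧ (∀ i ∈ D.labels, i ∈ l) ∧ D.height ≤ l.length ∧
      ∀ x, D.eval x = F x := by
  classical
  induction l generalizing F with
  | nil =>
    refine ⟨.leaf (F fun _ => false), trivial, ?_, le_rfl, fun x => hF _ _ (by simp)⟩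
    intro i hi
    exact absurd hi (Set.notMem_empty i)
  | cons a l ih =>
    obtain ⟨ha, hl'⟩ := List.nodup_cons.mp hl
    have key : ∀ b : Bool, ∀ x y : ι → Bool, (∀ i ∈ l, x i = y i) →
        F (Function.update x a b) = F (Function.update y a b) := by
      intro b x y hxy
      apply hF
      intro i hi
      by_cases h : i = a
      · subst h; simp
      · simp only [Function.update_of_ne h]
        exact hxy i ((List.mem_cons.mp hi).resolve_left h)
    obtain ⟨D₀, hn₀, hl₀, hh₀, he₀⟩ := ih hl' (fun x => F (Function.update x a false)) (key false)
    obtain ⟨D₁, hn₁, hl₁, hh₁, he₁⟩ := ih hl' (fun x => F (Function.update x a true)) (key true)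
    refine ⟨.query a D₀ D₁, ⟨fun h => ha (hl₀ a h), fun h => ha (hl₁ a h), hn₀, hn₁⟩, ?_, ?_, ?_⟩
    · rintro i (rfl | hi | hi)
      · exact List.mem_cons_self
      · exact List.mem_cons_of_mem _ (hl₀ i hi)
      · exact List.mem_cons_of_mem _ (hl₁ i hi)
    · simp only [DecisionTree.height, List.length_cons]
      omega
    · intro x
      cases hx : x a
      · simp only [DecisionTree.eval, hx, he₀]
        simp [← hx]
      · simp only [DecisionTree.eval, hx, he₁]
        simp [← hx]

/-- The tree that queries all bits shows that the minimum defining `randQuery` exists. -/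
theorem exists_computesWithin {ι : Type} [Fintype ι] (f : PartialFun ι) :
    ∃ R : RandTree ι, R.ComputesWithin f (Fintype.card ι) := by
  classical
  obtain ⟨D, hn, -, hh, he⟩ := exists_tree_of_list (Finset.univ : Finset ι).toList
    (Finset.nodup_toList _) (fun x => (f x).getD false) (by
      intro x y h
      have : x = y := funext fun i => h i (by simp)
      rw [this])
  refine ⟨PMF.pure ⟨D, hn⟩, ?_, ?_⟩
  · intro x hx
    have h0 : RandTree.err f (PMF.pure ⟨D, hn⟩) x = 0 := by
      refine ENNReal.tsum_eq_zero.mpr fun E => ?_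
      by_cases hE : E = ⟨D, hn⟩
      · subst hE
        obtain ⟨b, hb⟩ := Option.isSome_iff_exists.mp hx
        simp [he, hb]
      · simp [PMF.pure_apply, hE]
    rw [h0]
    exact zero_le
  · intro E hE
    rw [PMF.support_pure, Set.mem_singleton_iff] at hE
    subst hE
    simpa using hh

end QueryComplexity

/-! For each `g` and each `L > LR(g)` there is an outer function `f` with `R(f) > 0` and `R(f ∘ g) ≤
10 L R(f)` (`exists_randQuery_comp_le`). Inserting this `f` in the hypothesis on `M` and cancelling
`R(f)` gives `c M(g) ≤ 10 L`, and `L` tends to `LR(g)`.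

The function `f` is `approxIndex` with threshold `τ = s` and an address of `sN` bits: any string
that agrees with the address on `s` more positions than it disagrees on points to the answer.
Without composition this costs at least `s / 2` queries (`le_two_mul_randQuery_approxIndex`). For a
random address, a tree reveals the array value only if it reads a cell of correlation at least `s`;
each address query helps by a factor `exp l` at most in a Chernoff bound, and a union bound covers
the cells read.

In `f ∘ g`, an algorithm `R` with `cost ≤ L * bias` buys correlation with the address at a price of
`O(L)` queries per unit. Running it block by block until about `4 L s` queries are spent or the
address is exhausted gives expected correlation at least `2 s`, and an exponential supermartingale
shows that it is at least `s` with probability `2 / 3` (`searchAddress_fail_le`). It remains to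
evaluate `g` on one array cell. For `N` fixed by `g` and `s` large, the deviations of order `√(sN)`
are negligible against `s`. -/

namespace QueryComplexity

/-! ### Expectations under discrete distributions. -/

section Expectation

variable {α β : Type*}

/-- The expectation of an extended nonnegative function under a discrete distribution. -/
noncomputable def expect (p : PMF α) (φ : α → ℝ≥0∞) : ℝ≥0∞ := ∑' a, p a * φ a

theorem expect_mono_of_support {p : PMF α} {φ ψ : α → ℝ≥0∞} (h : ∀ a ∈ p.support, φ a ≤ ψ a) :
    expect p φ ≤ expect p ψ := by
  refine ENNReal.tsum_le_tsum fun a => ?_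
  by_cases ha : p a = 0
  · simp [ha]
  · exact mul_le_mul_right (h a ((p.mem_support_iff a).mpr ha)) _

theorem expect_mono {p : PMF α} {φ ψ : α → ℝ≥0∞} (h : ∀ a, φ a ≤ ψ a) :
    expect p φ ≤ expect p ψ :=
  expect_mono_of_support fun a _ => h a

theorem expect_const (p : PMF α) (c : ℝ≥0∞) : expect p (fun _ => c) = c := by
  simp [expect, ENNReal.tsum_mul_right, p.tsum_coe]

theorem expect_add (p : PMF α) (φ ψ : α → ℝ≥0∞) :
    expect p (fun a => φ a + ψ a) = expect p φ + expect p ψ := by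
  simp [expect, mul_add, ENNReal.tsum_add]

theorem expect_const_mul (p : PMF α) (c : ℝ≥0∞) (φ : α → ℝ≥0∞) :
    expect p (fun a => c * φ a) = c * expect p φ := by
  simp only [expect, ← ENNReal.tsum_mul_left]
  exact tsum_congr fun a => mul_left_comm _ _ _

theorem expect_sum {γ : Type*} (p : PMF α) (s : Finset γ) (φ : γ → α → ℝ≥0∞) :
    expect p (fun a => ∑ c ∈ s, φ c a) = ∑ c ∈ s, expect p (φ c) := by
  classical
  induction s using Finset.induction_on with
  | empty => simp [expect]
  | insert c s hc ih => simp only [Finset.sum_insert hc, expect_add, ih]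

theorem expect_pure (a : α) (φ : α → ℝ≥0∞) : expect (PMF.pure a) φ = φ a := by
  rw [expect, tsum_eq_single a]
  · simp
  · intro b hb
    simp [PMF.pure_apply, hb]

theorem expect_bind (p : PMF α) (q : α → PMF β) (φ : β → ℝ≥0∞) :
    expect (p.bind q) φ = expect p fun a => expect (q a) φ := by
  simp only [expect, PMF.bind_apply, ← ENNReal.tsum_mul_right, ← ENNReal.tsum_mul_left]
  rw [ENNReal.tsum_comm]
  exact tsum_congr fun a => tsum_congr fun b => mul_assoc _ _ _

theorem expect_map (p : PMF α) (u : α → β) (φ : β → ℝ≥0∞) :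
    expect (p.map u) φ = expect p fun a => φ (u a) := by
  rw [← PMF.bind_pure_comp, expect_bind]
  simp [expect_pure]

theorem expect_uniform_bool (φ : Bool → ℝ≥0∞) :
    expect (PMF.uniformOfFintype Bool) φ = 2⁻¹ * (φ true + φ false) := by
  simp [expect, mul_add]

end Expectation

/-! ### Heights of trees and removal of repeated queries. -/

namespace DecisionTree

variable {ι κ : Type}

theorem NoRepeat.height_le_card [DecidableEq ι] {D : DecisionTree ι} (hD : D.NoRepeat)
    {s : Finset ι} (hs : D.labels ⊆ s) : D.height ≤ s.card := by
  induction D generalizing s with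
  | leaf b => simp [height]
  | query i t₀ t₁ ih₀ ih₁ =>
    obtain ⟨h₀, h₁, hn₀, hn₁⟩ := hD
    have hi : i ∈ s := by simpa using hs (Set.mem_insert i _)
    have key : ∀ t : DecisionTree ι, i ∉ t.labels → t.labels ⊆ t₀.labels ∪ t₁.labels →
        t.labels ⊆ (s.erase i : Finset ι) := by
      intro t ht hsub j hj
      have hjs : j ∈ s := by simpa using hs (Set.mem_insert_of_mem _ (hsub hj))
      simp only [Finset.coe_erase, Set.mem_sdiff, Finset.mem_coe, Set.mem_singleton_iff]
      exact ⟨hjs, fun h => ht (h ▸ hj)⟩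
    have e₀ := ih₀ hn₀ (key t₀ h₀ Set.subset_union_left)
    have e₁ := ih₁ hn₁ (key t₁ h₁ Set.subset_union_right)
    have := Finset.card_erase_add_one hi
    simp only [height]
    omega

theorem cost_le_height (D : DecisionTree ι) (x : ι → Bool) : D.cost x ≤ D.height := by
  induction D with
  | leaf b => simp [cost, height]
  | query i t₀ t₁ ih₀ ih₁ =>
    simp only [cost, height]
    split <;> omega

/-- Removes every query whose answer is already recorded in `ρ` or by an earlier query. -/
def prune [DecidableEq ι] : DecisionTree ι → (ι → Option Bool) → DecisionTree ι
  | leaf b, _ => leaf b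
  | query i t₀ t₁, ρ =>
    match ρ i with
    | some true => t₁.prune ρ
    | some false => t₀.prune ρ
    | none => query i (t₀.prune (Function.update ρ i (some false)))
        (t₁.prune (Function.update ρ i (some true)))

variable [DecidableEq ι]

theorem prune_height_le (D : DecisionTree ι) (ρ : ι → Option Bool) :
    (D.prune ρ).height ≤ D.height := by
  induction D generalizing ρ with
  | leaf b => simp [prune]
  | query i t₀ t₁ ih₀ ih₁ =>
    rcases hρ : ρ i with _ | _ | _
    · have h₀ := ih₀ (Function.update ρ i (some false))
      have h₁ := ih₁ (Function.update ρ i (some true))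
      simp only [prune, hρ, height]
      omega
    · have h₀ := ih₀ ρ
      simp only [prune, hρ, height]
      omega
    · have h₁ := ih₁ ρ
      simp only [prune, hρ, height]
      omega

theorem prune_labels (D : DecisionTree ι) (ρ : ι → Option Bool) :
    ∀ i ∈ (D.prune ρ).labels, ρ i = none := by
  induction D generalizing ρ with
  | leaf b => simp [prune, labels]
  | query i t₀ t₁ ih₀ ih₁ =>
    rcases hρ : ρ i with _ | _ | _
    · simp only [prune, hρ, labels]
      rintro j (rfl | hj | hj)
      · exact hρ
      · have := ih₀ _ j hj
        by_cases hji : j = i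
        · subst hji; simp at this
        · rwa [Function.update_of_ne hji] at this
      · have := ih₁ _ j hj
        by_cases hji : j = i
        · subst hji; simp at this
        · rwa [Function.update_of_ne hji] at this
    · simpa only [prune, hρ] using ih₀ ρ
    · simpa only [prune, hρ] using ih₁ ρ

theorem prune_noRepeat (D : DecisionTree ι) (ρ : ι → Option Bool) : (D.prune ρ).NoRepeat := by
  induction D generalizing ρ with
  | leaf b => simp [prune, NoRepeat]
  | query i t₀ t₁ ih₀ ih₁ =>
    rcases hρ : ρ i with _ | _ | _
    · simp only [prune, hρ, NoRepeat]
      refine ⟨fun h => ?_, fun h => ?_, ih₀ _, ih₁ _⟩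
      · simpa using prune_labels _ _ _ h
      · simpa using prune_labels _ _ _ h
    · simpa only [prune, hρ] using ih₀ ρ
    · simpa only [prune, hρ] using ih₁ ρ

theorem prune_eval (D : DecisionTree ι) (ρ : ι → Option Bool) (x : ι → Bool)
    (hρ : ∀ i b, ρ i = some b → x i = b) : (D.prune ρ).eval x = D.eval x := by
  induction D generalizing ρ with
  | leaf b => simp [prune]
  | query i t₀ t₁ ih₀ ih₁ =>
    have key : ∀ b, x i = b → ∀ j c, Function.update ρ i (some b) j = some c → x j = c := by
      intro b hb j c hjc
      by_cases hji : j = i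
      · subst hji
        simp only [Function.update_self, Option.some.injEq] at hjc
        rw [hb, hjc]
      · rw [Function.update_of_ne hji] at hjc
        exact hρ j c hjc
    rcases h : ρ i with _ | _ | _
    · cases hx : x i
      · simp [prune, h, eval, hx, ih₀ _ (key _ hx)]
      · simp [prune, h, eval, hx, ih₁ _ (key _ hx)]
    · simp [prune, h, eval, hρ i _ h, ih₀ ρ hρ]
    · simp [prune, h, eval, hρ i _ h, ih₁ ρ hρ]


end DecisionTree

/-! ### The approximate index function and its hard inputs. -/

section ApproxIndex

variable {κ ι : Type} [Fintype κ]

/-- `1` if the two bits agree and `-1` if they do not. -/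
noncomputable def bitSign (b c : Bool) : ℝ := if b = c then 1 else -1

/-- The number of agreements minus the number of disagreements of two bit strings. -/
noncomputable def corr (z a : κ → Bool) : ℝ := ∑ i, bitSign (z i) (a i)

theorem corr_self (a : κ → Bool) : corr a a = Fintype.card κ := by
  simp [corr, bitSign]

/-- The approximate index function with threshold `τ`. The input consists of an address
`a : κ → Bool` and an array of bits indexed by bit strings, placed in `ι` by `e`. The promise is
that the array is constant on the strings having correlation at least `τ` with the address, and
the value is that constant. -/
noncomputable def approxIndex (e : κ ⊕ (κ → Bool) ≃ ι) (τ : ℝ) : PartialFun ι := fun x =>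
  open Classical in
  if ∀ z, τ ≤ corr z (fun i => x (e (.inl i))) → x (e (.inr z)) = x (e (.inr fun i => x (e (.inl i))))
  then some (x (e (.inr fun i => x (e (.inl i))))) else none

/-- The input with address `a` whose array is `b` near `a` and `false` elsewhere. -/
noncomputable def hiddenInput (e : κ ⊕ (κ → Bool) ≃ ι) (τ : ℝ) (a : κ → Bool) (b : Bool) :
    ι → Bool := fun j =>
  open Classical in
  match e.symm j with
  | .inl i => a i
  | .inr z => if τ ≤ corr z a then b else false

variable (e : κ ⊕ (κ → Bool) ≃ ι) {τ : ℝ}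

theorem hiddenInput_inl (a : κ → Bool) (b : Bool) (i : κ) :
    hiddenInput e τ a b (e (.inl i)) = a i := by
  simp [hiddenInput]

theorem hiddenInput_inr (a : κ → Bool) (b : Bool) (z : κ → Bool) [Decidable (τ ≤ corr z a)] :
    hiddenInput e τ a b (e (.inr z)) = if τ ≤ corr z a then b else false := by
  simp only [hiddenInput, Equiv.symm_apply_apply]
  congr

theorem approxIndex_hiddenInput (hτ : τ ≤ Fintype.card κ) (a : κ → Bool) (b : Bool) :
    approxIndex e τ (hiddenInput e τ a b) = some b := by
  classical
  have h : τ ≤ corr a a := by rwa [corr_self]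
  simp only [approxIndex, hiddenInput_inl, hiddenInput_inr, if_pos h]
  rw [if_pos]
  intro z hz
  rw [if_pos hz]

/-- This is why a search that finds the address only approximately suffices for the upper bound. -/
theorem approxIndex_eq_some {x : ι → Bool} {b : Bool} (h : approxIndex e τ x = some b)
    {z : κ → Bool} (hz : τ ≤ corr z fun i => x (e (.inl i))) : x (e (.inr z)) = b := by
  classical
  unfold approxIndex at h
  split at h
  · next hx =>
    rw [hx z hz]
    simpa using h
  · simp at h

/-! ### Query lower bound for approximate index. -/

/-- A bound on `∑ b ∈ s, exp (l * bitSign c b)` over both values of `c`. -/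
noncomputable def expWeight (l : ℝ) (s : Finset Bool) : ℝ :=
  (if false ∈ s ∨ true ∈ s then Real.exp l else 0) +
    if false ∈ s ∧ true ∈ s then Real.exp (-l) else 0

theorem expWeight_nonneg (l : ℝ) (s : Finset Bool) : 0 ≤ expWeight l s := by
  unfold expWeight
  positivity

theorem sum_exp_bitSign_le {l : ℝ} (hl : 0 ≤ l) (s : Finset Bool) (c : Bool) :
    ∑ b ∈ s, Real.exp (l * bitSign c b) ≤ expWeight l s := by
  have h : Real.exp (-l) ≤ Real.exp l := Real.exp_le_exp.mpr (by linarith)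
  have hs : s = ∅ ∨ s = {false} ∨ s = {true} ∨ s = {false, true} := by
    revert s; decide
  rcases hs with rfl | rfl | rfl | rfl <;> cases c <;>
    simp [expWeight, bitSign, h]
  linarith

/-- The price of an address query. When both bits are possible, the inequality is `2 * exp l ≤ exp
(2 * l) + 1`. -/
theorem expWeight_filter_add_le {l : ℝ} (hl : 0 ≤ l) (s : Finset Bool) :
    expWeight l (s.filter (· = false)) + expWeight l (s.filter (· = true)) ≤
      Real.exp l * expWeight l s := by
  have h1 : 1 ≤ Real.exp l := Real.one_le_exp hl
  have h2 : Real.exp l * Real.exp (-l) = 1 := by rw [← Real.exp_add]; simp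
  by_cases hf : false ∈ s <;> by_cases ht : true ∈ s <;>
    simp only [expWeight, Finset.mem_filter, hf, ht] <;> 
    simp <;> nlinarith

/-- Chernoff's method: the moment of `exp (l * corr z a)` over a subcube factorises over the
coordinates. The bound does not depend on `z`, so it serves every array cell. -/
theorem card_corr_le [DecidableEq κ] {l : ℝ} (hl : 0 ≤ l) (S : κ → Finset Bool) (z : κ → Bool)
    [DecidablePred fun a => τ ≤ corr z a] :
    (((Fintype.piFinset S).filter fun a => τ ≤ corr z a).card : ℝ) ≤
      Real.exp (-(l * τ)) * ∏ i, expWeight l (S i) := by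
  rw [Real.exp_neg, inv_mul_eq_div, le_div_iff₀ (Real.exp_pos _)]
  calc (((Fintype.piFinset S).filter fun a => τ ≤ corr z a).card : ℝ) * Real.exp (l * τ)
      = ∑ a ∈ (Fintype.piFinset S).filter (fun a => τ ≤ corr z a), Real.exp (l * τ) := by
        simp
    _ ≤ ∑ a ∈ (Fintype.piFinset S).filter (fun a => τ ≤ corr z a), Real.exp (l * corr z a) := by
        refine Finset.sum_le_sum fun a ha => Real.exp_le_exp.mpr ?_
        exact mul_le_mul_of_nonneg_left (Finset.mem_filter.mp ha).2 hl
    _ ≤ ∑ a ∈ Fintype.piFinset S, Real.exp (l * corr z a) :=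
        Finset.sum_le_sum_of_subset_of_nonneg (Finset.filter_subset _ _)
          fun a _ _ => (Real.exp_pos _).le
    _ = ∏ i, ∑ b ∈ S i, Real.exp (l * bitSign (z i) b) := by
        rw [Finset.prod_univ_sum]
        refine Finset.sum_congr rfl fun a _ => ?_
        rw [corr, Finset.mul_sum, Real.exp_sum]
    _ ≤ _ := Finset.prod_le_prod (fun i _ => Finset.sum_nonneg fun b _ => (Real.exp_pos _).le)
        fun i _ => sum_exp_bitSign_le hl _ _

/-- In every subcube, a shallow tree tells the two hidden inputs apart for few addresses. -/
theorem card_distinguished_le [DecidableEq κ] {l : ℝ} (hl : 0 ≤ l) (D : DecisionTree ι)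
    (S : κ → Finset Bool) :
    (((Fintype.piFinset S).filter fun a =>
      D.eval (hiddenInput e τ a true) ≠ D.eval (hiddenInput e τ a false)).card : ℝ) ≤
      D.height * Real.exp (l * D.height) * (Real.exp (-(l * τ)) * ∏ i, expWeight l (S i)) := by
  classical
  induction D generalizing S with
  | leaf b => simp [DecisionTree.eval, DecisionTree.height]
  | query j t₀ t₁ ih₀ ih₁ =>
    set H : ℕ := max t₀.height t₁.height with hH
    have hW : ∀ S : κ → Finset Bool, 0 ≤ Real.exp (-(l * τ)) * ∏ i, expWeight l (S i) :=
      fun S => mul_nonneg (Real.exp_pos _).le (Finset.prod_nonneg fun i _ => expWeight_nonneg _ _)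
    have mono : ∀ t : DecisionTree ι, t.height ≤ H → ∀ S : κ → Finset Bool,
        t.height * Real.exp (l * t.height) * (Real.exp (-(l * τ)) * ∏ i, expWeight l (S i)) ≤
        H * Real.exp (l * H) * (Real.exp (-(l * τ)) * ∏ i, expWeight l (S i)) := by
      intro t ht S
      have h' : (t.height : ℝ) ≤ H := Nat.cast_le.mpr ht
      refine mul_le_mul_of_nonneg_right ?_ (hW S)
      gcongr
    replace ih₀ := fun S => (ih₀ S).trans (mono t₀ (le_max_left _ _) S)
    replace ih₁ := fun S => (ih₁ S).trans (mono t₁ (le_max_right _ _) S)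
    have hheight : (((DecisionTree.query j t₀ t₁).height : ℕ) : ℝ) = 1 + H := by
      simp [DecisionTree.height, hH]
    rw [hheight]
    have hexp : Real.exp (l * (1 + H)) = Real.exp l * Real.exp (l * H) := by
      rw [← Real.exp_add]; ring_nf
    have hl1 : 1 ≤ Real.exp l := Real.one_le_exp hl
    have hH1 : 1 ≤ Real.exp (l * H) := Real.one_le_exp (by positivity)
    have hjj : e (e.symm j) = j := e.apply_symm_apply j
    rcases hj : e.symm j with i | z
    -- An address query splits the subcube in two; the potentials of the halves add up to at most
    -- `exp l` times the old one.
    · rw [hj] at hjj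
      subst hjj
      simp only [DecisionTree.eval, hiddenInput_inl]
      set S' : Bool → κ → Finset Bool := fun b =>
        Function.update S i ((S i).filter (· = b)) with hS'
      have hmem : ∀ b a, a ∈ Fintype.piFinset (S' b) ↔ a ∈ Fintype.piFinset S ∧ a i = b := by
        intro b a
        simp only [Fintype.mem_piFinset, hS']
        constructor
        · intro h
          have hi := h i
          simp only [Function.update_self, Finset.mem_filter] at hi
          refine ⟨fun i' => ?_, hi.2⟩
          by_cases hii : i' = i
          · subst hii; exact hi.1
          · simpa [Function.update_of_ne hii] using h i'
        · rintro ⟨h, hb⟩ i'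
          by_cases hii : i' = i
          · subst hii; simpa [hb] using h i'
          · simpa [Function.update_of_ne hii] using h i'
      have hsub : ((Fintype.piFinset S).filter fun a =>
          (if a i = true then t₁.eval (hiddenInput e τ a true)
            else t₀.eval (hiddenInput e τ a true)) ≠
          (if a i = true then t₁.eval (hiddenInput e τ a false)
            else t₀.eval (hiddenInput e τ a false))) ⊆
          ((Fintype.piFinset (S' false)).filter fun a =>
            t₀.eval (hiddenInput e τ a true) ≠ t₀.eval (hiddenInput e τ a false)) ∪
          ((Fintype.piFinset (S' true)).filter fun a =>
            t₁.eval (hiddenInput e τ a true) ≠ t₁.eval (hiddenInput e τ a false)) := by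
        intro a ha
        obtain ⟨h1, h2⟩ := Finset.mem_filter.mp ha
        rw [Finset.mem_union, Finset.mem_filter, Finset.mem_filter, hmem, hmem]
        cases hai : a i
        · exact Or.inl ⟨⟨h1, rfl⟩, by simpa [hai] using h2⟩
        · exact Or.inr ⟨⟨h1, rfl⟩, by simpa [hai] using h2⟩
      have hprod : (∏ i', expWeight l (S' false i')) + ∏ i', expWeight l (S' true i') ≤
          Real.exp l * ∏ i', expWeight l (S i') := by
        have hupd : ∀ b, ∏ i', expWeight l (S' b i') =
            expWeight l ((S i).filter (· = b)) *
              ∏ i' ∈ Finset.univ.erase i, expWeight l (S i') := by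
          intro b
          rw [← Finset.mul_prod_erase _ _ (Finset.mem_univ i)]
          congr 1
          · simp [hS']
          · refine Finset.prod_congr rfl fun i' hi' => ?_
            simp [hS', Function.update_of_ne (Finset.ne_of_mem_erase hi')]
        rw [hupd, hupd, ← add_mul, ← Finset.mul_prod_erase _ _ (Finset.mem_univ i), ← mul_assoc]
        exact mul_le_mul_of_nonneg_right (expWeight_filter_add_le hl _)
          (Finset.prod_nonneg fun i _ => expWeight_nonneg _ _)
      have hcard := (Finset.card_le_card hsub).trans (Finset.card_union_le _ _)
      calc _ ≤ _ := Nat.cast_le.mpr hcard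
        _ ≤ H * Real.exp (l * H) * (Real.exp (-(l * τ)) * ∏ i', expWeight l (S' false i')) +
            H * Real.exp (l * H) * (Real.exp (-(l * τ)) * ∏ i', expWeight l (S' true i')) := by
          push_cast
          exact add_le_add (ih₀ _) (ih₁ _)
        _ = H * Real.exp (l * H) * (Real.exp (-(l * τ)) *
            ((∏ i', expWeight l (S' false i')) + ∏ i', expWeight l (S' true i'))) := by ring
        _ ≤ H * Real.exp (l * H) * (Real.exp (-(l * τ)) *
            (Real.exp l * ∏ i', expWeight l (S i'))) := by gcongr
        _ = H * Real.exp (l * (1 + H)) * (Real.exp (-(l * τ)) * ∏ i', expWeight l (S i')) := by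
          rw [hexp]; ring
        _ ≤ _ := by
          refine mul_le_mul_of_nonneg_right ?_ (hW S)
          gcongr
          linarith
    -- An array query either hits a cell close to the address, which few addresses allow, or answers
    -- `false` on both hidden inputs, so that both continue in `t₀`.
    · rw [hj] at hjj
      subst hjj
      simp only [DecisionTree.eval, hiddenInput_inr]
      have hsub : ((Fintype.piFinset S).filter fun a =>
          (if (if τ ≤ corr z a then true else false) = true then t₁.eval (hiddenInput e τ a true)
            else t₀.eval (hiddenInput e τ a true)) ≠
          (if (if τ ≤ corr z a then false else false) = true then
            t₁.eval (hiddenInput e τ a false) else t₀.eval (hiddenInput e τ a false))) ⊆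
          ((Fintype.piFinset S).filter fun a => τ ≤ corr z a) ∪
          ((Fintype.piFinset S).filter fun a =>
            t₀.eval (hiddenInput e τ a true) ≠ t₀.eval (hiddenInput e τ a false)) := by
        intro a ha
        obtain ⟨h1, h2⟩ := Finset.mem_filter.mp ha
        rw [Finset.mem_union, Finset.mem_filter, Finset.mem_filter]
        by_cases hc : τ ≤ corr z a
        · exact Or.inl ⟨h1, hc⟩
        · exact Or.inr ⟨h1, by simpa [hc] using h2⟩
      have hcard := (Finset.card_le_card hsub).trans (Finset.card_union_le _ _)
      calc _ ≤ _ := Nat.cast_le.mpr hcard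
        _ ≤ Real.exp (-(l * τ)) * ∏ i, expWeight l (S i) +
            H * Real.exp (l * H) * (Real.exp (-(l * τ)) * ∏ i, expWeight l (S i)) := by
          push_cast
          exact add_le_add (card_corr_le hl S z) (ih₀ S)
        _ = (1 + H * Real.exp (l * H)) * (Real.exp (-(l * τ)) * ∏ i, expWeight l (S i)) := by ring
        _ ≤ _ := by
          refine mul_le_mul_of_nonneg_right ?_ (hW S)
          rw [hexp]
          nlinarith [mul_nonneg (Nat.cast_nonneg (α := ℝ) H) (sub_nonneg.mpr hH1),
            mul_le_mul hl1 le_rfl (Real.exp_pos (l * H)).le (by linarith : 0 ≤ Real.exp l),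
            mul_nonneg (mul_nonneg (Nat.cast_nonneg (α := ℝ) H) (Real.exp_pos (l * H)).le)
              (sub_nonneg.mpr hl1)]

/-- The cube has few addresses for which a tree of height at most `T` tells the two hidden
inputs apart. -/
theorem card_distinguished_cube_le [DecidableEq κ] {l : ℝ} (hl : 0 ≤ l) (D : DecisionTree ι) {T : ℕ}
    (hT : D.height ≤ T) :
    ((Finset.univ.filter fun a : κ → Bool =>
      D.eval (hiddenInput e τ a true) ≠ D.eval (hiddenInput e τ a false)).card : ℝ) ≤
      T * Real.exp (l * T - l * τ + Fintype.card κ * (l ^ 2 / 2)) *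
        Fintype.card (κ → Bool) := by
  classical
  have h := card_distinguished_le e (τ := τ) hl D fun _ => Finset.univ
  rw [Fintype.piFinset_univ] at h
  have hw : expWeight l Finset.univ ≤ 2 * Real.exp (l ^ 2 / 2) := by
    have := Real.cosh_le_exp_half_sq l
    rw [Real.cosh_eq] at this
    simp [expWeight]
    linarith
  have hT' : (D.height : ℝ) ≤ T := Nat.cast_le.mpr hT
  calc _ ≤ _ := h
    _ ≤ T * Real.exp (l * T) * (Real.exp (-(l * τ)) *
        ∏ _i : κ, (2 * Real.exp (l ^ 2 / 2))) := by
      have hp : ∏ _i : κ, expWeight l Finset.univ ≤ ∏ _i : κ, (2 * Real.exp (l ^ 2 / 2)) :=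
        Finset.prod_le_prod (fun i _ => expWeight_nonneg _ _) fun i _ => hw
      have h0 : 0 ≤ ∏ _i : κ, expWeight l Finset.univ :=
        Finset.prod_nonneg fun i _ => expWeight_nonneg _ _
      gcongr
    _ = _ := by
      rw [Real.exp_add, Real.exp_sub, Real.exp_neg]
      simp only [Finset.prod_const, Finset.card_univ, mul_pow, ← Real.exp_nat_mul,
        Fintype.card_fun, Fintype.card_bool]
      push_cast
      ring

/-- Trees distinguishing few pairs of hidden inputs do not compute the approximate index
function. -/
theorem not_computesWithin_approxIndex [DecidableEq κ] (hτ : τ ≤ Fintype.card κ) {T : ℕ}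
    (hT : ∀ D : DecisionTree ι, D.height ≤ T →
      4 * (Finset.univ.filter fun a : κ → Bool =>
        D.eval (hiddenInput e τ a true) ≠ D.eval (hiddenInput e τ a false)).card ≤
          Fintype.card (κ → Bool)) (R : RandTree ι) :
    ¬ R.ComputesWithin (approxIndex e τ) T := by
  classical
  rintro ⟨herr, hheight⟩
  set f := approxIndex e τ with hf
  have herr' : ∀ a b, RandTree.err f R (hiddenInput e τ a b) ≤ 1 / 3 := fun a b =>
    herr _ (by simp [PartialFun.dom, hf, approxIndex_hiddenInput e hτ])
  set V : ℝ≥0∞ := (Fintype.card (κ → Bool) : ℝ≥0∞) with hV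
  have hVtop : V ≠ ∞ := ENNReal.natCast_ne_top _
  have hV0 : V ≠ 0 := by simp [hV]
  -- At an address that `D` does not distinguish, the two hidden inputs have opposite values and
  -- receive the same output, so one of them is an error. At most a quarter of the addresses are
  -- exempt, and `2 / 3 + 1 / 4 < 1`.
  have key : V ≤ V * (2 / 3) + V / 4 := by
    calc V = expect R fun _ => V := (expect_const _ _).symm
      _ ≤ expect R fun D => (∑ a : κ → Bool,
          ((if f (hiddenInput e τ a true) = some (D.1.eval (hiddenInput e τ a true))
            then 0 else 1) +
          (if f (hiddenInput e τ a false) = some (D.1.eval (hiddenInput e τ a false))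
            then 0 else 1))) + V / 4 := by
        refine expect_mono_of_support fun D hD => ?_
        have h4 : ((Finset.univ.filter fun a : κ → Bool =>
            D.1.eval (hiddenInput e τ a true) ≠ D.1.eval (hiddenInput e τ a false)).card : ℝ≥0∞)
            ≤ V / 4 := by
          rw [ENNReal.le_div_iff_mul_le (by simp) (by simp), mul_comm, hV]
          exact_mod_cast hT D.1 (hheight D hD)
        refine le_trans ?_ (add_le_add le_rfl h4)
        rw [Finset.card_filter, Nat.cast_sum, ← Finset.sum_add_distrib, hV,
          ← Finset.card_univ, Finset.card_eq_sum_ones, Nat.cast_sum]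
        refine Finset.sum_le_sum fun a _ => ?_
        rw [hf, approxIndex_hiddenInput e hτ, approxIndex_hiddenInput e hτ]
        cases D.1.eval (hiddenInput e τ a true) <;>
          cases D.1.eval (hiddenInput e τ a false) <;> simp
      _ = (∑ a : κ → Bool, (RandTree.err f R (hiddenInput e τ a true) +
            RandTree.err f R (hiddenInput e τ a false))) + V / 4 := by
        rw [expect_add, expect_sum, expect_const]
        congr 1
        exact Finset.sum_congr rfl fun a _ => expect_add _ _ _
      _ ≤ (∑ _a : κ → Bool, (1 / 3 + 1 / 3)) + V / 4 := by
        gcongr <;> exact herr' _ _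
      _ = V * (2 / 3) + V / 4 := by
        rw [Finset.sum_const, Finset.card_univ, nsmul_eq_mul, ← hV, ENNReal.div_add_div_same,
          one_add_one_eq_two]
  have h1 : V * (2 / 3) ≠ ∞ := ENNReal.mul_ne_top hVtop (ENNReal.div_ne_top (by simp) (by simp))
  have h2 : V / 4 ≠ ∞ := ENNReal.div_ne_top hVtop (by simp)
  have hr := ENNReal.toReal_mono (ENNReal.add_ne_top.mpr ⟨h1, h2⟩) key
  rw [ENNReal.toReal_add h1 h2] at hr
  simp only [ENNReal.toReal_mul, ENNReal.toReal_div, ENNReal.toReal_ofNat] at hr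
  have : 0 < V.toReal := ENNReal.toReal_pos hV0 hVtop
  linarith

/-- Approximate index with threshold `τ` has query complexity at least `τ / 2`, as soon as `τ` is
somewhat larger than the standard deviation of the correlation. -/
theorem le_two_mul_randQuery_approxIndex [Fintype ι]
    (hτ : τ ≤ Fintype.card κ)
    (hk : 2 * τ * Real.exp (-(τ ^ 2 / (8 * Fintype.card κ))) ≤ 1) :
    τ ≤ 2 * (randQuery (approxIndex e τ) : ℝ) := by
  classical
  by_contra! hlt
  obtain ⟨R, hR⟩ := Nat.sInf_mem (s := {T : ℕ | ∃ R : RandTree ι,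
    R.ComputesWithin (approxIndex e τ) T}) ⟨_, exists_computesWithin (approxIndex e τ)⟩
  change R.ComputesWithin (approxIndex e τ) (randQuery (approxIndex e τ)) at hR
  set T := randQuery (approxIndex e τ)
  have hTτ : 0 < τ := lt_of_le_of_lt (by positivity) hlt
  have hcard : (0 : ℝ) < Fintype.card κ := hTτ.trans_le hτ
  refine not_computesWithin_approxIndex e hτ (fun D hD => ?_) R hR
  have h := card_distinguished_cube_le e (τ := τ) (l := τ / (2 * Fintype.card κ))
    (by positivity) D hD
  -- With `T < τ / 2` the exponent is at most `-l * τ / 2 + card κ * l ^ 2 / 2`, and this `l`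
  -- minimises that bound.
  set l : ℝ := τ / (2 * Fintype.card κ) with hl
  have hexp : l * T - l * τ + Fintype.card κ * (l ^ 2 / 2) ≤
      -(τ ^ 2 / (8 * Fintype.card κ)) := by
    have h1 : l * (2 * T) ≤ l * τ := mul_le_mul_of_nonneg_left hlt.le (by positivity)
    have h2 : -(τ ^ 2 / (8 * Fintype.card κ)) =
        -(l * τ / 2) + Fintype.card κ * (l ^ 2 / 2) := by
      rw [hl]; field_simp; ring
    linarith
  have h3 : (T : ℝ) * Real.exp (l * T - l * τ + Fintype.card κ * (l ^ 2 / 2)) ≤ 1 / 4 := by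
    calc _ ≤ τ / 2 * Real.exp (-(τ ^ 2 / (8 * Fintype.card κ))) :=
          mul_le_mul (by linarith) (Real.exp_le_exp.mpr hexp) (Real.exp_pos _).le (by positivity)
      _ ≤ 1 / 4 := by linarith
  have h4 := h.trans (mul_le_mul_of_nonneg_right h3 (Nat.cast_nonneg _))
  have h5 : (4 : ℝ) * (Finset.univ.filter fun a : κ → Bool =>
        D.eval (hiddenInput e τ a true) ≠ D.eval (hiddenInput e τ a false)).card ≤
          Fintype.card (κ → Bool) := by linarith
  exact_mod_cast h5

end ApproxIndex

/-! ### The search algorithm for the composed function. -/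

section Composition

variable {κ ι μ : Type}

/-- Runs a tree on block `j` of a composed input, then continues depending on its output and on
the number of queries made. -/
def DecisionTree.runBlock (j : ι) : DecisionTree μ → ℕ → (Bool → ℕ → DecisionTree (ι × μ)) →
    DecisionTree (ι × μ)
  | .leaf b, d, cont => cont b d
  | .query i t₀ t₁, d, cont =>
      .query (j, i) (t₀.runBlock j (d + 1) cont) (t₁.runBlock j (d + 1) cont)

theorem DecisionTree.runBlock_eval (j : ι) (D : DecisionTree μ) (d : ℕ)
    (cont : Bool → ℕ → DecisionTree (ι × μ)) (x : ι × μ → Bool) :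
    (D.runBlock j d cont).eval x =
      (cont (D.eval fun i => x (j, i)) (d + D.cost fun i => x (j, i))).eval x := by
  induction D generalizing d with
  | leaf b => simp [runBlock, eval, cost]
  | query i t₀ t₁ ih₀ ih₁ =>
    by_cases h : x (j, i) = true <;> simp [runBlock, eval, cost, h, ih₀, ih₁, add_assoc]

theorem DecisionTree.runBlock_height_le (j : ι) (D : DecisionTree μ) (d H : ℕ)
    (cont : Bool → ℕ → DecisionTree (ι × μ))
    (h : ∀ b c, c ≤ D.height → c + (cont b (d + c)).height ≤ H) :
    (D.runBlock j d cont).height ≤ H := by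
  induction D generalizing d H with
  | leaf b => simpa [runBlock, height] using h b 0
  | query i t₀ t₁ ih₀ ih₁ =>
    have hH : 1 ≤ H := by
      have := h true 1 (by simp [height])
      omega
    have key : ∀ t : DecisionTree μ, t.height ≤ max t₀.height t₁.height → ∀ b c, c ≤ t.height →
        c + (cont b (d + 1 + c)).height ≤ H - 1 := by
      intro t ht b c hc
      have := h b (1 + c) (by simp only [height]; omega)
      rw [← add_assoc] at this
      omega
    have e₀ := ih₀ (d + 1) (H - 1) (key t₀ (le_max_left _ _))
    have e₁ := ih₁ (d + 1) (H - 1) (key t₁ (le_max_right _ _))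
    simp only [runBlock, height]
    omega

/-- Guesses the bits of an address one after the other: while fewer than `B` queries have been
made, a fresh sample of `R` is run on the corresponding block, and afterwards the bits are chosen
uniformly at random. The result is a random continuation, whose arguments are the number of
queries made so far and the current guess of the address. -/
noncomputable def searchAddress [DecidableEq κ] (R : RandTree μ) (blk : κ → ι) (B : ℕ)
    (fin : (κ → Bool) → DecisionTree (ι × μ)) :
    List κ → PMF (ℕ → (κ → Bool) → DecisionTree (ι × μ))
  | [] => PMF.pure fun _ z => fin z
  | i :: is => R.bind fun D => (PMF.uniformOfFintype Bool).bind fun u =>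
      (searchAddress R blk B fin is).map fun K c z =>
        if c < B then
          D.1.runBlock (blk i) 0 fun b c' => K (c + c') (Function.update z i b)
        else K c (Function.update z i u)

/-- The budget is tested only before a run, so it is overshot by one run at most, which makes at
most `card μ` queries because no bit is repeated. -/
theorem searchAddress_height_le [DecidableEq κ] [Fintype μ] (R : RandTree μ) (blk : κ → ι) (B H : ℕ)
    (fin : (κ → Bool) → DecisionTree (ι × μ)) (hfin : ∀ z, (fin z).height ≤ H) (is : List κ) :
    ∀ K ∈ (searchAddress R blk B fin is).support, ∀ c z,
      (K c z).height ≤ (B + Fintype.card μ - c) + H := by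
  classical
  induction is with
  | nil =>
    intro K hK c z
    rw [searchAddress, PMF.support_pure, Set.mem_singleton_iff] at hK
    subst hK
    exact (hfin z).trans (by omega)
  | cons i is ih =>
    intro K hK c z
    simp only [searchAddress, PMF.mem_support_bind_iff, PMF.support_map, Set.mem_image] at hK
    obtain ⟨D, -, u, -, K', hK', rfl⟩ := hK
    beta_reduce
    split
    · refine DecisionTree.runBlock_height_le _ _ _ _ _ fun b c' hc' => ?_
      have h1 := ih K' hK' (c + (0 + c')) (Function.update z i b)
      have h2 : D.1.height ≤ Fintype.card μ := by
        simpa using D.2.height_le_card (s := Finset.univ) (by simp)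
      omega
    · exact ih K' hK' _ _

/-! ### Exponential moments and the failure probability of the search. -/

theorem exp_neg_le_of_abs_le_one {y : ℝ} (hy : |y| ≤ 1) : Real.exp (-y) ≤ 1 - y + y ^ 2 := by
  have := (abs_le.mp (Real.abs_exp_sub_one_sub_id_le (x := -y) (by rwa [abs_neg]))).2
  linarith [neg_sq y]

theorem bitSign_eq (b c : Bool) : bitSign b c = 1 - 2 * (if b = c then 0 else 1) := by
  unfold bitSign
  split <;> norm_num

theorem abs_bitSign (b c : Bool) : |bitSign b c| = 1 := by
  unfold bitSign
  split <;> simp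

/-- A uniform guess has mean correlation zero, so the linear term vanishes. This controls the
positions reached after the budget is spent. -/
theorem expect_exp_uniform_le {l : ℝ} (hl : 0 ≤ l) (hl1 : l ≤ 1) (b : Bool) :
    expect (PMF.uniformOfFintype Bool) (fun u => ENNReal.ofReal (Real.exp (-(l * bitSign u b)))) ≤
      ENNReal.ofReal (1 + l ^ 2) := by
  have h1 := exp_neg_le_of_abs_le_one (y := l) (by rwa [abs_of_nonneg hl])
  have h2 := exp_neg_le_of_abs_le_one (y := -l) (by rwa [abs_neg, abs_of_nonneg hl])
  rw [expect_uniform_bool, ← ENNReal.ofReal_add (Real.exp_pos _).le (Real.exp_pos _).le,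
    show (2⁻¹ : ℝ≥0∞) = ENNReal.ofReal 2⁻¹ by
      rw [ENNReal.ofReal_inv_of_pos two_pos]; simp,
    ← ENNReal.ofReal_mul (by norm_num)]
  refine ENNReal.ofReal_le_ofReal ?_
  cases b <;> simp [bitSign] at * <;> linarith

/-- The exponential moment of the agreement of a small-bias algorithm with `g`, discounted by the
queries made. -/
theorem expect_exp_run_le [Fintype μ] {g : PartialFun μ} {R : RandTree μ} {y : μ → Bool} {a : Bool}
    (ha : g y = some a) {l w v Q : ℝ} (hl : 0 < l) (hw : 0 ≤ w) (hv : 0 ≤ v)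
    (hQ : 1 + w * Fintype.card μ + v ≤ Q) (hlQ : l * Q ≤ 1)
    (hR : 2 * RandTree.err g R y + ENNReal.ofReal w * RandTree.cost R y + ENNReal.ofReal v ≤ 1) :
    expect R (fun D => ENNReal.ofReal
      (Real.exp (-(l * (bitSign (D.1.eval y) a - w * D.1.cost y - v))))) ≤
      ENNReal.ofReal (1 + (l * Q) ^ 2) := by
  classical
  -- This is `exp (-l Y) ≤ 1 - l Y + (l Q) ^ 2` for `Y = bitSign - w * cost - v`, rearranged with
  -- `l` on the left so that no subtraction occurs in `ℝ≥0∞`. On average the linear term is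
  -- harmless, since `hR` says that `Y` has nonnegative mean.
  have hpt : ∀ D : {D : DecisionTree μ // D.NoRepeat},
      ENNReal.ofReal (Real.exp (-(l * (bitSign (D.1.eval y) a - w * D.1.cost y - v)))) +
        ENNReal.ofReal l ≤ ENNReal.ofReal (1 + (l * Q) ^ 2) + ENNReal.ofReal l *
          (2 * (if g y = some (D.1.eval y) then 0 else 1) +
            ENNReal.ofReal w * (D.1.cost y : ℝ≥0∞) + ENNReal.ofReal v) := by
    intro D
    have hc : (D.1.cost y : ℝ) ≤ Fintype.card μ := by
      refine Nat.cast_le.mpr ((D.1.cost_le_height y).trans ?_)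
      simpa using D.2.height_le_card (s := Finset.univ) (by simp)
    have hc0 : (0 : ℝ) ≤ D.1.cost y := Nat.cast_nonneg _
    have hwc := mul_le_mul_of_nonneg_left hc hw
    have hwc0 := mul_nonneg hw hc0
    set e : ℝ := if D.1.eval y = a then 0 else 1 with he
    have he0 : 0 ≤ e := by rw [he]; positivity
    have he1 : (if g y = some (D.1.eval y) then 0 else 1 : ℝ≥0∞) = ENNReal.ofReal e := by
      rw [ha, he]
      by_cases h : D.1.eval y = a
      · simp [h]
      · simp [h, Ne.symm h]
    have habs : |bitSign (D.1.eval y) a - w * D.1.cost y - v| ≤ Q := by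
      have := abs_le.mp (abs_bitSign (D.1.eval y) a).le
      rw [abs_le]
      constructor <;> linarith
    have habs' : |l * (bitSign (D.1.eval y) a - w * D.1.cost y - v)| ≤ l * Q := by
      rw [abs_mul, abs_of_pos hl]
      exact mul_le_mul_of_nonneg_left habs hl.le
    have hexp := exp_neg_le_of_abs_le_one (habs'.trans hlQ)
    have hsq : (l * (bitSign (D.1.eval y) a - w * D.1.cost y - v)) ^ 2 ≤ (l * Q) ^ 2 :=
      sq_le_sq' (abs_le.mp habs').1 (abs_le.mp habs').2
    rw [he1, ← ENNReal.ofReal_natCast, ← ENNReal.ofReal_ofNat 2, ← ENNReal.ofReal_mul (by norm_num),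
      ← ENNReal.ofReal_mul hw, ← ENNReal.ofReal_add (by positivity) hwc0,
      ← ENNReal.ofReal_add (by positivity) hv, ← ENNReal.ofReal_mul hl.le,
      ← ENNReal.ofReal_add (by positivity) (by positivity),
      ← ENNReal.ofReal_add (by positivity) (by positivity)]
    refine ENNReal.ofReal_le_ofReal ?_
    have hb : bitSign (D.1.eval y) a = 1 - 2 * e := by rw [bitSign_eq]
    rw [hb] at hexp hsq ⊢
    linarith
  have hE := expect_mono (p := R) hpt
  simp only [expect_add, expect_const, expect_const_mul] at hE
  refine ENNReal.le_of_add_le_add_right (a := ENNReal.ofReal l) (by simp) (hE.trans ?_)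
  gcongr
  exact mul_le_of_le_one_right' hR

/-- The probability that the guessed address is far from the true one is bounded by an
exponential potential: `A` is a lower bound for the sum of the correlations expected so far. -/
theorem searchAddress_fail_le [DecidableEq κ] [Fintype κ] [Fintype μ] {g : PartialFun μ}
    {R : RandTree μ} {blk : κ → ι} {B : ℕ} {fin : (κ → Bool) → DecisionTree (ι × μ)}
    {x : ι × μ → Bool} {a : κ → Bool} (ha : ∀ i, g (fun j => x (blk i, j)) = some (a i))
    {τ : ℝ} {b : Bool} (hfin : ∀ z, τ ≤ corr z a → (fin z).eval x = b)
    {l w v Q : ℝ} (hl : 0 < l) (hw : 0 ≤ w) (hv : 0 ≤ v)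
    (hQ : 1 + w * Fintype.card μ + v ≤ Q) (hlQ : l * Q ≤ 1) (hB : 2 * τ ≤ w * B)
    (hR : ∀ i, 2 * RandTree.err g R (fun j => x (blk i, j)) +
      ENNReal.ofReal w * RandTree.cost R (fun j => x (blk i, j)) + ENNReal.ofReal v ≤ 1)
    (is : List κ) (his : is.Nodup) (c : ℕ) (z : κ → Bool) (A : ℝ)
    (hA : 2 * τ ≤ A ∨ w * c ≤ A ∧ 2 * τ ≤ A + is.length * v) :
    expect (searchAddress R blk B fin is) (fun K => if (K c z).eval x = b then 0 else 1) ≤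
      ENNReal.ofReal ((1 + (l * Q) ^ 2) ^ is.length *
        Real.exp (-(l * ((∑ i ∈ Finset.univ \ is.toFinset, bitSign (z i) (a i)) - A + τ)))) := by
  induction is generalizing c z A with
  | nil =>
    rw [searchAddress, expect_pure]
    split
    · exact zero_le
    · next h =>
      have hz : corr z a < τ := lt_of_not_ge fun hz => h (hfin z hz)
      -- At the end the credit `A` is at least `2 * τ`, while failure means correlation below `τ`;
      -- hence the exponent is nonnegative and the bound is at least `1`.
      have hA' : 2 * τ ≤ A := by
        rcases hA with hA | ⟨-, hA⟩
        · exact hA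
        · simpa using hA
      rw [← ENNReal.ofReal_one]
      refine ENNReal.ofReal_le_ofReal ?_
      simp only [List.length_nil, pow_zero, one_mul, List.toFinset_nil, Finset.sdiff_empty]
      refine Real.one_le_exp ?_
      change 0 ≤ -(l * (corr z a - A + τ))
      nlinarith
  | cons i is ih =>
    obtain ⟨hi, his'⟩ := List.nodup_cons.mp his
    have hsum : ∀ u, (∑ i' ∈ Finset.univ \ is.toFinset,
        bitSign (Function.update z i u i') (a i')) = bitSign u (a i) +
        ∑ i' ∈ Finset.univ \ (i :: is).toFinset, bitSign (z i') (a i') := by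
      intro u
      have hset : Finset.univ \ is.toFinset =
          insert i (Finset.univ \ (i :: is).toFinset) := by
        ext i'
        by_cases hii : i' = i
        · subst hii; simp [hi]
        · simp [hii]
      rw [hset, Finset.sum_insert (by simp)]
      congr 1
      · simp
      · refine Finset.sum_congr rfl fun i' hi' => ?_
        have hii : i' ≠ i := by rintro rfl; simp at hi'
        rw [Function.update_of_ne hii]
    set S := ∑ i' ∈ Finset.univ \ (i :: is).toFinset, bitSign (z i') (a i')
    set C := 1 + (l * Q) ^ 2 with hC
    have hC0 : 0 ≤ C := by positivity
    have hfact : ∀ Y d : ℝ, ENNReal.ofReal (C ^ is.length *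
        Real.exp (-(l * (Y + S - (A + d) + τ)))) =
        ENNReal.ofReal (C ^ is.length * Real.exp (-(l * (S - A + τ)))) *
          ENNReal.ofReal (Real.exp (-(l * (Y - d)))) := by
      intro Y d
      rw [← ENNReal.ofReal_mul (by positivity), mul_assoc, ← Real.exp_add]
      congr 3
      ring
    have hgoal : ENNReal.ofReal (C ^ (i :: is).length * Real.exp (-(l * (S - A + τ)))) =
        ENNReal.ofReal (C ^ is.length * Real.exp (-(l * (S - A + τ)))) * ENNReal.ofReal C := by
      rw [← ENNReal.ofReal_mul (by positivity), List.length_cons, pow_succ]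
      congr 1
      ring
    rw [hgoal]
    simp only [searchAddress, expect_bind, expect_map]
    by_cases hc : c < B
    · simp only [hc, if_true, DecisionTree.runBlock_eval, expect_const, zero_add]
      refine le_trans (expect_mono fun D => ?_) (le_trans (expect_const_mul R _ _).le
        (mul_le_mul_right (expect_exp_run_le (ha i) hl hw hv hQ hlQ (hR i)) _))
      -- The credit grows by `w * cost + v`: the first term tracks the budget, the second guarantees
      -- progress on blocks where `R` is cheap.
      have := ih his' (c + D.1.cost fun j => x (blk i, j))
        (Function.update z i (D.1.eval fun j => x (blk i, j)))
        (A + (w * D.1.cost (fun j => x (blk i, j)) + v)) (by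
          have hwc : 0 ≤ w * (D.1.cost fun j => x (blk i, j)) := by positivity
          rcases hA with hA | ⟨hA, hA'⟩
          · left; linarith
          · right
            rw [List.length_cons] at hA'
            push_cast at hA' ⊢
            constructor <;> linarith)
      rw [hsum, hfact] at this
      simpa only [sub_sub] using this
    · simp only [hc, if_false, expect_const]
      -- A spent budget already means `A ≥ w * c ≥ w * B ≥ 2 * τ`, so the credit can stay frozen
      -- from here on.
      have hA' : 2 * τ ≤ A := by
        rcases hA with hA | ⟨hA, -⟩
        · exact hA
        · have : (B : ℝ) ≤ c := Nat.cast_le.mpr (not_lt.mp hc)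
          linarith [mul_le_mul_of_nonneg_left this hw]
      have hQ1 : 1 ≤ Q := by
        have : 0 ≤ w * Fintype.card μ := by positivity
        linarith
      have hlQ' : l ≤ l * Q := le_mul_of_one_le_right hl.le hQ1
      have hCle : ENNReal.ofReal (1 + l ^ 2) ≤ ENNReal.ofReal C := by
        refine ENNReal.ofReal_le_ofReal ?_
        rw [hC]
        gcongr
      refine le_trans (expect_mono fun u => ?_) (le_trans (expect_const_mul _ _ _).le
        (mul_le_mul_right ((expect_exp_uniform_le hl.le (hlQ'.trans hlQ) (a i)).trans hCle) _))
      have := ih his' c (Function.update z i u) (A + 0) (Or.inl (by linarith))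
      rw [hsum, hfact] at this
      simpa only [sub_zero] using this

theorem comp_eq_some {f : PartialFun ι} {g : PartialFun μ} {x : ι × μ → Bool} {b : Bool}
    (h : f.comp g x = some b) :
    ∃ y : ι → Bool, (∀ i, g (fun j => x (i, j)) = some (y i)) ∧ f y = some b := by
  classical
  unfold PartialFun.comp at h
  split at h
  · next hx => exact ⟨_, fun i => (Option.some_get (hx i)).symm, h⟩
  · simp at h

/-- An algorithm for `g` whose cost is linear in its bias yields an algorithm for the composition
of approximate index with `g`. -/
theorem exists_computesWithin_approxIndex_comp [Fintype κ] [Fintype μ]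
    (e : κ ⊕ (κ → Bool) ≃ ι) {g : PartialFun μ} {R : RandTree μ} {B : ℕ}
    {τ l w v Q : ℝ} (hl : 0 < l) (hw : 0 ≤ w) (hv : 0 ≤ v)
    (hQ : 1 + w * Fintype.card μ + v ≤ Q) (hlQ : l * Q ≤ 1) (hB : 2 * τ ≤ w * B)
    (hR : ∀ y ∈ g.dom, 2 * RandTree.err g R y +
      ENNReal.ofReal w * RandTree.cost R y + ENNReal.ofReal v ≤ 1)
    (hκ : 2 * τ ≤ Fintype.card κ * v)
    (hsmall : (1 + (l * Q) ^ 2) ^ Fintype.card κ * Real.exp (-(l * τ)) ≤ 1 / 3) :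
    ∃ R' : RandTree (ι × μ), R'.ComputesWithin ((approxIndex e τ).comp g)
      (B + 2 * Fintype.card μ) := by
  classical
  obtain ⟨E, -, -, hEh, hE⟩ := exists_tree_of_list (Finset.univ : Finset μ).toList
    (Finset.nodup_toList _) (fun y => (g y).getD false) (by
      intro x y h
      rw [funext fun i => h i (by simp)])
  have hEh' : E.height ≤ Fintype.card μ := by simpa using hEh
  set fin : (κ → Bool) → DecisionTree (ι × μ) := fun z =>
    E.runBlock (e (.inr z)) 0 fun b _ => .leaf b with hfin
  set P := searchAddress R (fun i => e (.inl i)) B fin Finset.univ.toList with hP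
  -- The initial guess is immaterial, as the search overwrites every coordinate. Pruning yields
  -- `NoRepeat` without an analysis of which blocks are visited.
  set out : (ℕ → (κ → Bool) → DecisionTree (ι × μ)) →
      {D : DecisionTree (ι × μ) // D.NoRepeat} := fun K =>
    ⟨(K 0 fun _ => false).prune fun _ => none, DecisionTree.prune_noRepeat _ _⟩ with hout
  refine ⟨P.map out, fun x hx => ?_, fun D hD => ?_⟩
  · obtain ⟨b, hb⟩ := Option.isSome_iff_exists.mp hx
    obtain ⟨y, hy, hfy⟩ := comp_eq_some hb
    have hfinx : ∀ z, τ ≤ corr z (fun i => y (e (.inl i))) → (fin z).eval x = b := by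
      intro z hz
      have hyz := approxIndex_eq_some e hfy hz
      simp [hfin, DecisionTree.runBlock_eval, DecisionTree.eval, hE, hy, hyz]
    have h := searchAddress_fail_le (blk := fun i => e (.inl i)) (fun i => hy _) hfinx hl hw hv
      hQ hlQ hB (fun i => hR _ (by simp [PartialFun.dom, hy])) Finset.univ.toList
      (Finset.nodup_toList _) 0 (fun _ => false) 0 (Or.inr (by simpa using hκ))
    have herr : RandTree.err ((approxIndex e τ).comp g) (P.map out) x =
        expect P (fun K => if (K 0 fun _ => false).eval x = b then 0 else 1) := by
      change expect (P.map out) (fun D => if _ = some (D.1.eval x) then 0 else 1) = _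
      rw [expect_map]
      congr 1
      funext K
      have hpr := DecisionTree.prune_eval (K 0 fun _ => false) (fun _ => none) x (by simp)
      simp only [hout, hpr, hb, Option.some.injEq]
      exact if_congr eq_comm rfl rfl
    rw [herr]
    refine h.trans ?_
    rw [show (1 / 3 : ℝ≥0∞) = ENNReal.ofReal (1 / 3) by
      rw [ENNReal.ofReal_div_of_pos (by norm_num)]; simp]
    refine ENNReal.ofReal_le_ofReal ?_
    simpa using hsmall
  · rw [PMF.support_map] at hD
    obtain ⟨K, hK, rfl⟩ := hD
    have h := searchAddress_height_le R (fun i => e (.inl i)) B (Fintype.card μ) fin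
      (fun z => DecisionTree.runBlock_height_le _ _ _ _ _ fun b c hc => by
        simpa [DecisionTree.height] using hc.trans hEh') _ K hK 0 fun _ => false
    have h' := DecisionTree.prune_height_le (K 0 fun _ => false) fun _ => none
    simp only [hout]
    omega

end Composition

/-! ### Choice of parameters and conclusion. -/

open Filter

/-- The ratio bound of `linRandQuery`, with the cost and a positive lower bound of the bias on one
side. -/
theorem exists_linear_randTree {μ : Type} [Finite μ] {g : PartialFun μ} {L : ℝ} (hL : 0 < L)
    (h : linRandQuery g < ENNReal.ofReal L) :
    ∃ (R : RandTree μ) (v : ℝ), 0 < v ∧ ∀ y ∈ g.dom, 2 * RandTree.err g R y +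
      ENNReal.ofReal (1 / (2 * L)) * RandTree.cost R y + ENNReal.ofReal v ≤ 1 := by
  classical
  obtain ⟨R, hR⟩ := iInf_lt_iff.mp h
  have hratio : ∀ y ∈ g.dom, R.ratio g y < ENNReal.ofReal L := fun y hy =>
    (le_iSup₂ (f := fun x (_ : x ∈ g.dom) => R.ratio g x) y hy).trans_lt hR
  have hbias : ∀ y ∈ g.dom, R.bias g y ≠ 0 := by
    intro y hy h0
    have := hratio y hy
    simp [RandTree.ratio, h0] at this
  have hbias1 : ∀ y, R.bias g y ≤ 1 := fun y => tsub_le_self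
  have hbiastop : ∀ y, R.bias g y ≠ ∞ := fun y => ((hbias1 y).trans_lt ENNReal.one_lt_top).ne
  have hcost : ∀ y ∈ g.dom, R.cost y ≤ ENNReal.ofReal L * R.bias g y := by
    intro y hy
    have := (hratio y hy).le
    rw [RandTree.ratio, if_neg (hbias y hy)] at this
    exact (ENNReal.div_le_iff (hbias y hy) (hbiastop y)).mp this
  -- There are finitely many inputs, so the bias is bounded away from `0`. Half of the bias will pay
  -- for the cost, the other half for the constant `γ / 2`.
  obtain ⟨γ, hγ, hγb⟩ : ∃ γ : ℝ, 0 < γ ∧ ∀ y ∈ g.dom, ENNReal.ofReal γ ≤ R.bias g y := by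
    rcases g.dom.eq_empty_or_nonempty with hd | hd
    · exact ⟨1, one_pos, by simp [hd]⟩
    · obtain ⟨y, hy, hmin⟩ := g.dom.exists_min_image (R.bias g) (Set.toFinite _) hd
      refine ⟨(R.bias g y).toReal, ENNReal.toReal_pos (hbias y hy) (hbiastop y), fun z hz => ?_⟩
      rw [ENNReal.ofReal_toReal (hbiastop y)]
      exact hmin z hz
  have hhalf : ∀ t : ℝ, ENNReal.ofReal (t / 2) = ENNReal.ofReal t / 2 := fun t => by
    rw [ENNReal.ofReal_div_of_pos two_pos, ENNReal.ofReal_ofNat]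
  refine ⟨R, γ / 2, by positivity, fun y hy => ?_⟩
  have h1 : ENNReal.ofReal (1 / (2 * L)) * R.cost y ≤ R.bias g y / 2 := by
    calc _ ≤ ENNReal.ofReal (1 / (2 * L)) * (ENNReal.ofReal L * R.bias g y) := by
          gcongr
          exact hcost y hy
      _ = R.bias g y / 2 := by
          rw [← mul_assoc, ← ENNReal.ofReal_mul (by positivity),
            show 1 / (2 * L) * L = 1 / 2 by field_simp, hhalf, ENNReal.ofReal_one,
            ENNReal.div_eq_inv_mul, ENNReal.div_eq_inv_mul, mul_one]
  have h2 : ENNReal.ofReal (γ / 2) ≤ R.bias g y / 2 := by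
    rw [hhalf]
    exact ENNReal.div_le_div_right (hγb y hy) 2
  -- A nonzero bias shows that the subtraction defining it was not truncated.
  have h3 : 2 * R.err g y ≤ 1 := by
    by_contra! hlt
    exact hbias y hy (tsub_eq_zero_of_le hlt.le)
  calc _ ≤ 2 * R.err g y + R.bias g y / 2 + R.bias g y / 2 := by gcongr
    _ = 2 * R.err g y + R.bias g y := by rw [add_assoc, ENNReal.add_halves]
    _ = 1 := add_tsub_cancel_of_le h3

/-- Some nonconstant outer function composes with `g` at a cost of at most `10 * L` per query,
whenever `L` exceeds the linearised complexity of `g`. -/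
theorem exists_randQuery_comp_le {μ : Type} [Fintype μ] {g : PartialFun μ} {L : ℝ} (hL : 0 < L)
    (h : linRandQuery g < ENNReal.ofReal L) :
    ∃ (n : ℕ) (f : PartialFun (Fin n)), 0 < randQuery f ∧
      (randQuery (f.comp g) : ℝ) ≤ 10 * L * randQuery f := by
  classical
  obtain ⟨R, v, hv, hR⟩ := exists_linear_randTree hL h
  set m : ℝ := (Fintype.card μ : ℝ) with hm
  set w : ℝ := 1 / (2 * L) with hw
  have hw0 : 0 < w := by positivity
  set Q : ℝ := 1 + w * m + v with hQ
  have hQ1 : 1 ≤ Q := by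
    have : 0 ≤ w * m := by positivity
    linarith
  -- With `N * v ≥ 2`, an address of `s * N` bits earns credit `2 * s` even if the budget is never
  -- spent.
  obtain ⟨N, hN⟩ := exists_nat_ge (max 1 (2 / v))
  have hN1 : (1 : ℝ) ≤ N := (le_max_left _ _).trans hN
  have hNv : 2 ≤ N * v := (div_le_iff₀ hv).mp ((le_max_right _ _).trans hN)
  -- Chosen so that `N * (l * Q) ^ 2 = l / 2`: the second-order loss over `s * N` bits is half of
  -- the gain `l * s`.
  set l : ℝ := 1 / (2 * N * Q ^ 2) with hl
  have hN0 : (0 : ℝ) < N := by linarith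
  have hQ0 : 0 < Q := by linarith
  have hl0 : 0 < l := by
    rw [hl]
    exact one_div_pos.mpr (mul_pos (by linarith) (pow_pos hQ0 2))
  have hlQ : l * Q ≤ 1 := by
    rw [hl, div_mul_eq_mul_div, one_mul, div_le_one (by positivity)]
    nlinarith [mul_le_mul hN1 hQ1 zero_le_one hN0.le]
  have hNl : N * (l * Q) ^ 2 = l / 2 := by
    rw [hl]; field_simp
  have ev1 : ∀ᶠ s : ℕ in atTop, 2 * (s : ℝ) * Real.exp (-(s / (8 * N))) ≤ 1 := by
    have h1 := (Real.tendsto_pow_mul_exp_neg_atTop_nhds_zero 1).comp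
      (tendsto_natCast_atTop_atTop.atTop_div_const (r := 8 * (N : ℝ)) (by positivity))
    filter_upwards [h1.eventually_le_const (u := 1 / (16 * (N : ℝ)))
      (one_div_pos.mpr (by linarith))] with s hs
    simp only [Function.comp_apply, pow_one] at hs
    rw [le_div_iff₀ (by positivity)] at hs
    refine le_trans (le_of_eq ?_) hs
    field_simp
    ring
  have ev2 : ∀ᶠ s : ℕ in atTop, Real.exp (-(l / 2 * s)) ≤ 1 / 3 := by
    have h1 := Real.tendsto_exp_neg_atTop_nhds_zero.comp
      (tendsto_natCast_atTop_atTop.const_mul_atTop (r := l / 2) (by positivity))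
    exact h1.eventually_le_const (by norm_num)
  -- Absorbs the overshoot, the final evaluation of `g` and the rounding of the budget: the total is
  -- at most `5 * L * s`, hence `10 * L * randQuery f`.
  have ev3 : ∀ᶠ s : ℕ in atTop, 2 * m + 1 ≤ L * s :=
    (tendsto_natCast_atTop_atTop.const_mul_atTop hL).eventually_ge_atTop _
  obtain ⟨s, hs1, hs2, hs3, hs⟩ := (ev1.and (ev2.and (ev3.and (eventually_ge_atTop 1)))).exists
  have hs' : (1 : ℝ) ≤ s := by exact_mod_cast hs
  set e := Fintype.equivFin (Fin (s * N) ⊕ (Fin (s * N) → Bool))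
  have hcard : (Fintype.card (Fin (s * N)) : ℝ) = s * N := by simp
  have hlow : (s : ℝ) ≤ 2 * (randQuery (approxIndex e s) : ℝ) := by
    refine le_two_mul_randQuery_approxIndex e ?_ ?_
    · rw [hcard]; nlinarith
    · rw [hcard, show (s : ℝ) ^ 2 / (8 * (s * N)) = s / (8 * N) by field_simp]
      exact hs1
  obtain ⟨R', hR'⟩ := exists_computesWithin_approxIndex_comp e (g := g) (R := R)
    -- As `w = 1 / (2 * L)`, a spent budget of `4 * L * s` is worth credit `2 * s`.
    (B := ⌈4 * L * s⌉₊) (τ := s) hl0 hw0.le hv.le hQ.ge hlQ (by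
      calc (2 : ℝ) * s = w * (4 * L * s) := by rw [hw]; field_simp; ring
        _ ≤ _ := by gcongr; exact Nat.le_ceil _) hR (by rw [hcard]; nlinarith) (by
      calc (1 + (l * Q) ^ 2) ^ Fintype.card (Fin (s * N)) * Real.exp (-(l * s))
          ≤ Real.exp ((l * Q) ^ 2) ^ Fintype.card (Fin (s * N)) * Real.exp (-(l * s)) := by
            gcongr
            linarith [Real.add_one_le_exp ((l * Q) ^ 2)]
        _ = Real.exp (-(l / 2 * s)) := by
            rw [← Real.exp_nat_mul, ← Real.exp_add, hcard, mul_assoc, hNl]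
            congr 1
            ring
        _ ≤ 1 / 3 := hs2)
  refine ⟨_, approxIndex e s, ?_, ?_⟩
  · have : (0 : ℝ) < randQuery (approxIndex e s) := by linarith
    exact_mod_cast this
  · have hup : randQuery ((approxIndex e s).comp g) ≤ ⌈4 * L * s⌉₊ + 2 * Fintype.card μ :=
      Nat.sInf_le ⟨R', hR'⟩
    have hup' : (randQuery ((approxIndex e s).comp g) : ℝ) ≤ ⌈4 * L * s⌉₊ + 2 * m := by
      rw [hm]
      exact_mod_cast hup
    have hceil := Nat.ceil_lt_add_one (a := 4 * L * s) (by positivity)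
    nlinarith [mul_le_mul_of_nonneg_left hlow hL.le]

end QueryComplexity

theorem theorem1p3
    (M : ∀ m : ℕ, QueryComplexity.PartialFun (Fin m) → ENNReal)
    (hM : ∃ c : NNReal, 0 < c ∧
      ∀ (n m : ℕ) (f : QueryComplexity.PartialFun (Fin n))
        (g : QueryComplexity.PartialFun (Fin m)),
        (c : ENNReal) * ((QueryComplexity.randQuery f : ENNReal) * M m g) ≤
          (QueryComplexity.randQuery (f.comp g) : ENNReal)) :
    ∃ c' : NNReal, 0 < c' ∧
      ∀ (m : ℕ) (g : QueryComplexity.PartialFun (Fin m)),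
        (c' : ENNReal) * M m g ≤ QueryComplexity.linRandQuery g := by
  obtain ⟨c, hc, hcM⟩ := hM
  refine ⟨c / 10, by positivity, fun m g => ?_⟩
  -- The slack `ε` makes `L` strictly larger than `LR(g)`, also when the latter is `0`; an infinite
  -- `LR(g)` leaves nothing to prove.
  refine ENNReal.le_of_forall_pos_le_add fun ε hε htop => ?_
  set L : ℝ := (QueryComplexity.linRandQuery g).toReal + ε with hL
  have hL0 : 0 < L := add_pos_of_nonneg_of_pos ENNReal.toReal_nonneg hε
  have hLe : ENNReal.ofReal L = QueryComplexity.linRandQuery g + ε := by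
    rw [hL, ENNReal.ofReal_add ENNReal.toReal_nonneg ε.coe_nonneg, ENNReal.ofReal_toReal htop.ne,
      ENNReal.ofReal_coe_nnreal]
  obtain ⟨n, f, hf, hfg⟩ := QueryComplexity.exists_randQuery_comp_le (g := g) hL0 (by
    rw [hLe]
    exact ENNReal.lt_add_right htop.ne (by exact_mod_cast hε.ne'))
  -- Since `randQuery f` is nonzero and finite, it cancels even if `M m g` is infinite.
  have hr0 : (QueryComplexity.randQuery f : ENNReal) ≠ 0 := by exact_mod_cast hf.ne'
  have hrt : (QueryComplexity.randQuery f : ENNReal) ≠ ⊤ := ENNReal.natCast_ne_top _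
  have h1 : (c : ENNReal) * M m g * QueryComplexity.randQuery f ≤
      10 * ENNReal.ofReal L * QueryComplexity.randQuery f := by
    calc _ = (c : ENNReal) * (QueryComplexity.randQuery f * M m g) := by ring
      _ ≤ (QueryComplexity.randQuery (f.comp g) : ENNReal) := hcM n m f g
      _ ≤ ENNReal.ofReal (10 * L * QueryComplexity.randQuery f) := by
        rw [← ENNReal.ofReal_natCast]
        exact ENNReal.ofReal_le_ofReal hfg
      _ = _ := by
        rw [ENNReal.ofReal_mul (by positivity), ENNReal.ofReal_mul (by norm_num),
          ENNReal.ofReal_natCast, ENNReal.ofReal_ofNat]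
  have h2 : (c : ENNReal) * M m g ≤ 10 * ENNReal.ofReal L :=
    (ENNReal.mul_le_mul_iff_left hr0 hrt).mp h1
  rw [← hLe, ENNReal.coe_div (by norm_num), ENNReal.coe_ofNat, ENNReal.mul_comm_div,
    ← mul_div_assoc]
  exact ENNReal.div_le_of_le_mul' h2
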